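/- Let $\gamma>0$ and $V^0,v_0>0$. Let $I=[0,\infty)$ or $I=\mathbb R$, and let $g:I\to\mathbb R$ be differentiable and monotonically decreasing (in the weak sense) with $g'$ bounded and $-V^0\le g\le -v_0$. For $\alpha\ge 0$ let $C_\alpha$ be the space of continuous $f:\mathbb R\to\mathbb R$ with $|f|_\alpha:=\sup_x e^{\alpha|x|}|f(x)|<\infty$, and let $H_0=L^2(\mathbb R)$. For an initial temperature $u^0\in C_\alpha$ with values in $I$ let $v\in C[0,\infty)$ be the interface velocity and $s(t)=\int_0^t v(\tau)\,d\tau$ the interface position, and write, in the frame $x'=x-s(t)$ attached to the interface, $T(t)u^0=T_1(t)u^0+T_2(t)u^0$, where for $t>0$ $$T_1(t)u^0(x')=-\int_0^t e^{-\gamma(t-\tau)}G(x'+s(t),t,s(\tau),\tau)\,v(\tau)\,d\tau,\qquad T_2(t)u^0(x')=e^{-\gamma t}\int_{-\infty}^\infty G(x'+s(t),t,\xi,0)\,u^0(\xi)\,d\xi,$$ with $G(x,t,\xi,\tau)=(4\pi(t-\tau))^{-1/2}\exp\{-(x-\xi)^2/(4(t-\tau))\}$, while $T_1(0)u^0=0$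 and $T_2(0)u^0=u^0$; the velocity $v$ is a solution of the integral equation $v(t)=g\big((T(t)u^0)(0)\big)$, $t>0$, with $(T(t)u^0)(0)\in I$. (Thus $u(x,t)=(T(t)u^0)(x-s(t))$ is the solution, given by its single-layer potential representation, of the free interface problem $u_t=u_{xx}-\gamma u$ for $x\ne s(t)$, $u(\cdot,0)=u^0$, $g(u(s(t),t))=v(t)=[u_x(s(t),t)]$.) Put $\alpha_{time}=\frac{V^0}{2}\big(\sqrt{1+4\gamma/(V^0)^2}-1\big)$, $\alpha_{space}=\min\big(\frac{v_0}{4},\frac{\gamma}{2V^0}\big)$, $\alpha_{\min}=\min(\alpha_{time},\alpha_{space})$ and $\kappa(\gamma,\alpha)=\gamma-\alpha^2-\alpha V^0$. There is an absolute constant $C>0$ such that for all such $\gamma,V^0,v_0,I,g$ and all $0<\alpha<\alpha_{\min}$ the following hold, where $X_N$ denotes the set of $I$-valued $u\in C_\alpha$ with $|u|_\alpha\le N$ (the whole ball if $I=\mathbb R$). 1. $\kappa(\gamma,\alpha)>0$, and for all $N\ge0$ and $t\ge0$ the functions $T_2(t)u^0$, $u^0\in X_N$, lie in $H_0$ and $\displaystyle\sup_{u^0\in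 X_N}\|T_2(t)u^0\|_{H_0}\le C\,e^{-\kappa(\gamma,\alpha)t}\,\frac{N}{\sqrt\alpha}.$ 2. For all $N\ge0$ and $t_0>0$ the orbit $\bigcup_{t\ge t_0}T_1(t)X_N$ is a relatively compact subset of $H_0$. 3. For every $\varepsilon>0$ the $\omega$-limit set $\mathcal A_\alpha=\bigcap_{t_0\ge0}\overline{\bigcup_{t\ge t_0}T(t)B_a}$ (closure in $C_\alpha$) of the ball $B_a=X_N$ with $N=V^0/\sqrt\gamma+\varepsilon$ is a relatively compact subset of $H_0$. -/

import Mathlib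

noncomputable section

namespace Stefan

open MeasureTheory Set

/-! ### Weighted spaces -/

/-- The norm `|f|_α = sup_x e^{α|x|} |f x|`, with value `∞` allowed. -/
def weightedSupNorm (α : ℝ) (f : ℝ → ℝ) : ENNReal :=
  ⨆ x : ℝ, ENNReal.ofReal (Real.exp (α * |x|) * |f x|)

/-- The space `C_α` of continuous functions on the line with `|f|_α < ∞`. -/
def CAlpha (α : ℝ) : Set (ℝ → ℝ) :=
  {f | Continuous f ∧ weightedSupNorm α f < ⊤}

/-- The closed ball of radius `N` of `C_α`, consisting of initial temperatures with values in the
range `I` of admissible temperatures (no restriction if `I = ℝ`). -/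
def initialBall (I : Set ℝ) (α N : ℝ) : Set (ℝ → ℝ) :=
  {u | u ∈ CAlpha α ∧ (∀ x, u x ∈ I) ∧ weightedSupNorm α u ≤ ENNReal.ofReal N}

/-- The closure of a set of functions in the normed space `C_α`. -/
def closureCAlpha (α : ℝ) (S : Set (ℝ → ℝ)) : Set (ℝ → ℝ) :=
  {f | f ∈ CAlpha α ∧ ∀ δ : ENNReal, 0 < δ → ∃ h ∈ S, weightedSupNorm α (f - h) < δ}

/-- A set of functions on the line is relatively compact in `H_0 = L²(ℝ)`: all its elements are
square integrable, and the set of their classes has compact closure in `L²(ℝ)`. -/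
def RelativelyCompactInH0 (S : Set (ℝ → ℝ)) : Prop :=
  (∀ f ∈ S, MemLp f 2 (volume : Measure ℝ)) ∧
    IsCompact (closure {F : Lp ℝ 2 (volume : Measure ℝ) | ∃ f ∈ S, (F : ℝ → ℝ) =ᵐ[volume] f})

/-! ### The kinetics -/

/-- The assumptions on the kinetic function `g`. It is defined on the range `I` of admissible
temperatures, which is `[0, ∞)` or the whole line; its values outside `I` play no role. -/
structure IsKinetics (I : Set ℝ) (g : ℝ → ℝ) (V₀ v₀ : ℝ) : Prop where
  range_eq : I = Ici 0 ∨ I = univ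
  V_pos : 0 < V₀
  v_pos : 0 < v₀
  antitone : AntitoneOn g I
  differentiable : DifferentiableOn ℝ g I
  deriv_bounded : ∃ K : ℝ, ∀ u ∈ I, |derivWithin g I u| ≤ K
  lower : ∀ u ∈ I, -V₀ ≤ g u
  upper : ∀ u ∈ I, g u ≤ -v₀

/-! ### The solution operator -/

/-- The heat kernel `G(x,t,ξ,τ)`, for `τ < t`. -/
def heatKernel (x t ξ τ : ℝ) : ℝ :=
  Real.exp (-(x - ξ) ^ 2 / (4 * (t - τ))) / Real.sqrt (4 * Real.pi * (t - τ))

/-- The position `s(t) = ∫₀ᵗ v` of the interface. -/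
def position (v : ℝ → ℝ) (t : ℝ) : ℝ := ∫ τ in (0 : ℝ)..t, v τ

/-- The contribution of the initial data at time `t`, in the frame attached to the interface:
the argument `x` stands for the point `x + s(t)` of the laboratory frame. At time `0` it is the
initial datum itself. -/
def T2 (γ : ℝ) (v u₀ : ℝ → ℝ) (t x : ℝ) : ℝ :=
  if t = 0 then u₀ x
  else Real.exp (-γ * t) * ∫ ξ : ℝ, heatKernel (x + position v t) t ξ 0 * u₀ ξ

/-- The contribution of the free interface at time `t`, in the frame attached to it. -/
def T1 (γ : ℝ) (v : ℝ → ℝ) (t x : ℝ) : ℝ :=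
  -∫ τ in (0 : ℝ)..t,
    Real.exp (-γ * (t - τ)) * heatKernel (x + position v t) t (position v τ) τ * v τ

/-- The solution at time `t`, in the frame attached to the interface. -/
def T (γ : ℝ) (v u₀ : ℝ → ℝ) (t x : ℝ) : ℝ := T1 γ v t x + T2 γ v u₀ t x

/-- `v` is the velocity of the interface for the initial datum `u₀`: it is continuous on `[0, ∞)`
and solves the integral equation `v(t) = g(u(s(t), t))`, where the temperature `u(s(t), t)` at the
interface (the origin of the attached frame) lies in the range where `g` is defined. -/
def IsVelocity (γ : ℝ) (I : Set ℝ) (g u₀ v : ℝ → ℝ) : Prop :=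
  ContinuousOn v (Ici 0) ∧ ∀ t : ℝ, 0 < t → T γ v u₀ t 0 ∈ I ∧ v t = g (T γ v u₀ t 0)

/-- The set `⋃_{t ≥ t₀} T_1(t) X`. -/
def orbitT1 (γ : ℝ) (I : Set ℝ) (g : ℝ → ℝ) (X : Set (ℝ → ℝ)) (t₀ : ℝ) : Set (ℝ → ℝ) :=
  {f | ∃ u₀ ∈ X, ∃ v, IsVelocity γ I g u₀ v ∧ ∃ t, t₀ ≤ t ∧ f = T1 γ v t}

/-- The set `⋃_{t ≥ t₀} T(t) X`. -/
def orbitT (γ : ℝ) (I : Set ℝ) (g : ℝ → ℝ) (X : Set (ℝ → ℝ)) (t₀ : ℝ) : Set (ℝ → ℝ) :=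
  {f | ∃ u₀ ∈ X, ∃ v, IsVelocity γ I g u₀ v ∧ ∃ t, t₀ ≤ t ∧ f = T γ v u₀ t}

/-- The `ω`-limit set in `C_α` of a set `B` of initial data:
the intersection over `t₀ ≥ 0` of the `C_α`-closures of `⋃_{t ≥ t₀} T(t) B`. -/
def omegaLimitSet (γ : ℝ) (I : Set ℝ) (g : ℝ → ℝ) (α : ℝ) (B : Set (ℝ → ℝ)) : Set (ℝ → ℝ) :=
  ⋂ t₀ ∈ Ici (0 : ℝ), closureCAlpha α (orbitT γ I g B t₀)

/-- The set `𝒜_α`: the `ω`-limit set of the ball of radius `V₀ / √γ + ε`. -/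
def attractor (γ : ℝ) (I : Set ℝ) (g : ℝ → ℝ) (V₀ α ε : ℝ) : Set (ℝ → ℝ) :=
  omegaLimitSet γ I g α (initialBall I α (V₀ / Real.sqrt γ + ε))

/-! ### The constants -/

def alphaTime (γ V₀ : ℝ) : ℝ := V₀ / 2 * (Real.sqrt (1 + 4 * γ / V₀ ^ 2) - 1)

def alphaSpace (γ V₀ v₀ : ℝ) : ℝ := min (v₀ / 4) (γ / (2 * V₀))

def alphaMin (γ V₀ v₀ : ℝ) : ℝ := min (alphaTime γ V₀) (alphaSpace γ V₀ v₀)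

def kappa (γ V₀ α : ℝ) : ℝ := γ - α ^ 2 - α * V₀

end Stefan

end

noncomputable section

namespace Stefan

open MeasureTheory Set Filter Topology

/-! ### A class of functions that is compact in `L²` -/

/-! A uniform exponential decay together with a uniform Hölder constant forces relative compactness
in `L²`: Arzelà–Ascoli gives locally uniform compactness, and the exponential envelope prevents mass
from escaping to infinity.

The single-layer potentials share such bounds. Write `r = t - τ`. Completing the square bounds the
Gaussian by `exp (α² r - α d)`, where `d` is the distance to the interface at time `τ`. The speed is
at most `V₀`, so `d ≥ |x| - V₀ r`. Together with the damping `exp (-γ r)` this leaves `exp (-α|x|)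
r^(-1/2) exp (-κ r)`, integrable in `r` because `κ > 0`. A Hölder bound in `x` with exponent 1/2
costs `r^(-3/4) exp (-γ r)`, still integrable. Neither constant depends on time, datum or velocity
(`T1_mem_decayingHolder`).

The initial-data term is `exp (-γ t)` times a Gaussian average of translates, hence contracts both
in `L²` (part 1, with `C = 1`) and in the sup norm. So it vanishes in the limit, and the `ω`-limit
set lies in the pointwise closure of the single-layer potentials, where the same bounds persist. -/

/-- The functions with a fixed exponential decay and a fixed Hölder constant for the
exponent `1/2`. -/
def decayingHolder (α M L : ℝ) : Set (ℝ → ℝ) :=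
  {f | (∀ x, |f x| ≤ M * Real.exp (-α * |x|)) ∧ ∀ x y, |f x - f y| ≤ L * Real.sqrt |x - y|}

lemma isClosed_decayingHolder (α M L : ℝ) : IsClosed (decayingHolder α M L) := by
  have h : decayingHolder α M L =
      (⋂ x, {f : ℝ → ℝ | |f x| ≤ M * Real.exp (-α * |x|)}) ∩
        ⋂ x, ⋂ y, {f : ℝ → ℝ | |f x - f y| ≤ L * Real.sqrt |x - y|} := by
    ext f
    simp [decayingHolder]
  rw [h]
  refine (isClosed_iInter fun x => ?_).inter (isClosed_iInter fun x => isClosed_iInter fun y => ?_)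
  · exact isClosed_le (by fun_prop) continuous_const
  · exact isClosed_le (by fun_prop) continuous_const

lemma isCompact_decayingHolder (α M L : ℝ) : IsCompact (decayingHolder α M L) := by
  refine (isCompact_univ_pi fun x : ℝ =>
    isCompact_Icc (a := -(M * Real.exp (-α * |x|))) (b := M * Real.exp (-α * |x|))).of_isClosed_subset
    (isClosed_decayingHolder α M L) ?_
  intro f hf x _
  exact abs_le.1 (hf.1 x)

lemma uniformEquicontinuous_decayingHolder (α M L : ℝ) :
    UniformEquicontinuous ((↑) : decayingHolder α M L → ℝ → ℝ) := by
  refine Metric.uniformEquicontinuous_of_continuity_modulus (fun r => L * Real.sqrt r) ?_ _ ?_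
  · have : Continuous fun r => L * Real.sqrt r := by fun_prop
    simpa using this.tendsto 0
  · intro x y f
    simpa [Real.dist_eq] using f.2.2 x y

lemma continuous_of_mem_decayingHolder {α M L : ℝ} {f : ℝ → ℝ} (hf : f ∈ decayingHolder α M L) :
    Continuous f :=
  (uniformEquicontinuous_decayingHolder α M L).equicontinuous.continuous ⟨f, hf⟩

/-- Arzelà–Ascoli upgrades pointwise compactness to the compact-open topology. Its neighbourhood
filters are countably generated, which the dominated convergence argument into `L²` requires. -/
lemma isCompact_continuousMap_decayingHolder (α M L : ℝ) :
    IsCompact {f : C(ℝ, ℝ) | (f : ℝ → ℝ) ∈ decayingHolder α M L} := by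
  refine ArzelaAscoli.isCompact_of_equicontinuous _ ?_ ?_
  · convert isCompact_decayingHolder α M L using 1
    ext f
    constructor
    · rintro ⟨h, hh, rfl⟩
      exact hh
    · intro hf
      exact ⟨⟨f, continuous_of_mem_decayingHolder hf⟩, hf, rfl⟩
  · exact ((uniformEquicontinuous_decayingHolder α M L).comp
      fun f : {f : C(ℝ, ℝ) | (f : ℝ → ℝ) ∈ decayingHolder α M L} => ⟨f.1, f.2⟩).equicontinuous

lemma integrable_exp_neg_mul_abs {a : ℝ} (ha : 0 < a) :
    Integrable fun x : ℝ => Real.exp (-a * |x|) := by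
  by_contra h
  have h1 := integral_comp_abs (f := fun x => Real.exp (-a * x))
  -- Without integrability the left side would be `0` by convention, whereas the formula, valid
  -- unconditionally, gives `2 / a`.
  rw [integral_undef h, integral_exp_mul_Ioi (by linarith)] at h1
  simp [ha.ne'] at h1

lemma lintegral_sq_exp_neg_mul_abs {α M : ℝ} (hα : 0 < α) :
    ∫⁻ x : ℝ, ‖M * Real.exp (-α * |x|)‖ₑ ^ 2 = ENNReal.ofReal (M ^ 2 / α) := by
  have h1 : ∀ x : ℝ, ‖M * Real.exp (-α * |x|)‖ₑ ^ 2 =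
      ENNReal.ofReal (M ^ 2 * Real.exp (-(2 * α) * |x|)) := by
    intro x
    rw [← ofReal_norm, ← ENNReal.ofReal_pow (norm_nonneg _), Real.norm_eq_abs, sq_abs,
      mul_pow, ← Real.exp_nat_mul]
    congr 3
    push_cast
    ring
  simp_rw [h1]
  rw [← ofReal_integral_eq_lintegral_ofReal
    ((integrable_exp_neg_mul_abs (by linarith)).const_mul _)
    (Eventually.of_forall fun x => by positivity), integral_const_mul,
    integral_comp_abs (f := fun x => Real.exp (-(2 * α) * x)),
    integral_exp_mul_Ioi (by linarith)]
  congr 1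
  simp
  field_simp

lemma eLpNorm_two_sq (f : ℝ → ℝ) (μ : Measure ℝ) :
    eLpNorm f 2 μ ^ 2 = ∫⁻ x, ‖f x‖ₑ ^ 2 ∂μ := by
  simpa using eLpNorm_nnreal_pow_eq_lintegral (f := f) (μ := μ) (p := 2) (by norm_num)

lemma eLpNorm_le_of_abs_le_exp {α M : ℝ} (hα : 0 < α) (hM : 0 ≤ M) {f : ℝ → ℝ}
    (h : ∀ x, |f x| ≤ M * Real.exp (-α * |x|)) :
    eLpNorm f 2 volume ≤ ENNReal.ofReal (M / Real.sqrt α) := by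
  refine (ENNReal.pow_le_pow_left_iff two_ne_zero).1 ?_
  rw [eLpNorm_two_sq, ← ENNReal.ofReal_pow (by positivity), div_pow, Real.sq_sqrt hα.le,
    ← lintegral_sq_exp_neg_mul_abs hα]
  refine lintegral_mono fun x => ?_
  gcongr
  rw [enorm_le_iff_norm_le, Real.norm_eq_abs, Real.norm_eq_abs]
  exact (h x).trans (le_abs_self _)

lemma memLp_of_abs_le_exp {α M : ℝ} (hα : 0 < α) {f : ℝ → ℝ} (hf : Continuous f)
    (h : ∀ x, |f x| ≤ M * Real.exp (-α * |x|)) : MemLp f 2 volume := by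
  refine ⟨hf.aestronglyMeasurable, (eLpNorm_le_of_abs_le_exp hα (abs_nonneg M) fun x => ?_).trans_lt
    ENNReal.ofReal_lt_top⟩
  exact (h x).trans (by gcongr; exact le_abs_self M)

/-- Every set of functions with uniform exponential decay and a uniform Hölder constant is
relatively compact in `L²`. -/
lemma relativelyCompactInH0_of_subset_decayingHolder {α M L : ℝ} (hα : 0 < α) {S : Set (ℝ → ℝ)}
    (hS : S ⊆ decayingHolder α M L) : RelativelyCompactInH0 S := by
  have hmem : ∀ f ∈ decayingHolder α M L, MemLp f 2 (volume : Measure ℝ) := fun f hf =>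
    memLp_of_abs_le_exp hα (continuous_of_mem_decayingHolder hf) hf.1
  refine ⟨fun f hf => hmem f (hS hf), ?_⟩
  set K : Set C(ℝ, ℝ) := {f | (f : ℝ → ℝ) ∈ decayingHolder α M L}
  have hK : IsCompact K := isCompact_continuousMap_decayingHolder α M L
  have : CompactSpace K := isCompact_iff_compactSpace.1 hK
  let Φ : K → Lp ℝ 2 (volume : Measure ℝ) := fun f => (hmem f.1 f.2).toLp
  have hΦ : Continuous Φ := by
    refine continuous_iff_continuousAt.2 fun f => ?_
    refine (Lp.tendsto_Lp_iff_tendsto_eLpNorm'' _ _ _ _).2 ?_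
    have hlim : Tendsto (fun h : K => ∫⁻ x, ‖(h.1 : ℝ → ℝ) x - f.1 x‖ₑ ^ 2) (𝓝 f)
        (𝓝 (∫⁻ _ : ℝ, 0)) := by
      refine tendsto_lintegral_filter_of_dominated_convergence
        -- Two members of the class differ by at most twice the common envelope.
        (fun x => ‖(2 * M) * Real.exp (-α * |x|)‖ₑ ^ 2) ?_ ?_ ?_ ?_
      · exact Eventually.of_forall fun h => by fun_prop
      · refine Eventually.of_forall fun h => Eventually.of_forall fun x => ?_
        gcongr
        rw [enorm_le_iff_norm_le, Real.norm_eq_abs, Real.norm_eq_abs]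
        refine le_trans ?_ (le_abs_self _)
        have h1 := h.2.1 x
        have h2 := f.2.1 x
        have h3 := abs_sub ((h.1 : ℝ → ℝ) x) (f.1 x)
        linarith
      · rw [lintegral_sq_exp_neg_mul_abs hα]
        exact ENNReal.ofReal_ne_top
      · refine Eventually.of_forall fun x => ?_
        have hc : Continuous fun h : K => ‖(h.1 : ℝ → ℝ) x - f.1 x‖ₑ ^ 2 := by
          have : Continuous fun h : K => (h.1 : ℝ → ℝ) x :=
            (continuous_eval_const x).comp continuous_subtype_val
          exact (ENNReal.continuous_pow 2).comp (this.sub continuous_const).enorm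
        simpa using hc.tendsto f
    have hsqrt := (ENNReal.continuous_rpow_const (y := (1 / 2 : ℝ))).tendsto _ |>.comp hlim
    simp only [lintegral_zero] at hsqrt
    rw [ENNReal.zero_rpow_of_pos (by norm_num)] at hsqrt
    refine hsqrt.congr fun h => ?_
    simp only [Function.comp_apply]
    rw [← eLpNorm_two_sq (fun x => (h.1 : ℝ → ℝ) x - f.1 x) volume, ← ENNReal.rpow_natCast,
      ← ENNReal.rpow_mul]
    norm_num
    rfl
  have hrange : IsCompact (range Φ) := isCompact_range hΦ
  refine hrange.of_isClosed_subset isClosed_closure (closure_minimal ?_ hrange.isClosed)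
  rintro F ⟨f, hf, hFf⟩
  refine ⟨⟨⟨f, continuous_of_mem_decayingHolder (hS hf)⟩, hS hf⟩, ?_⟩
  exact Lp.ext ((hmem f (hS hf)).coeFn_toLp.trans hFf.symm)

/-! ### Estimates of the single-layer potential -/

/-- Interpolation: the difference is at most `1` and at most `|p - q|`, so its square is at most `|p
- q|`. The Lipschitz bound alone would lead to the singularity `(t - τ)^(-1)`, which is not
integrable. -/
lemma abs_exp_neg_sq_sub_le (p q : ℝ) :
    |Real.exp (-p ^ 2) - Real.exp (-q ^ 2)| ≤ Real.sqrt |p - q| := by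
  have hlip : |Real.exp (-p ^ 2) - Real.exp (-q ^ 2)| ≤ |p - q| := by
    have hd : ∀ x ∈ (univ : Set ℝ), HasDerivWithinAt (fun y : ℝ => Real.exp (-y ^ 2))
        (Real.exp (-x ^ 2) * (-(2 * x))) univ x := by
      intro x _
      have h := ((hasDerivAt_pow 2 x).neg).exp.hasDerivWithinAt (s := univ)
      simpa using h
    have hb : ∀ x ∈ (univ : Set ℝ), ‖Real.exp (-x ^ 2) * (-(2 * x))‖ ≤ 1 := by
      intro x _
      rw [norm_mul, norm_neg, Real.norm_eq_abs, Real.norm_eq_abs, Real.abs_exp, Real.exp_neg,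
        inv_mul_le_one₀ (Real.exp_pos _)]
      refine le_trans ?_ (Real.add_one_le_exp (x ^ 2))
      rw [abs_mul, abs_two, ← sq_abs x]
      nlinarith [sq_nonneg (|x| - 1)]
    simpa using convex_univ.norm_image_sub_le_of_norm_hasDerivWithin_le hd hb (mem_univ q)
      (mem_univ p)
  have hone : |Real.exp (-p ^ 2) - Real.exp (-q ^ 2)| ≤ 1 := by
    have hp : Real.exp (-p ^ 2) ≤ 1 := Real.exp_le_one_iff.2 (by nlinarith [sq_nonneg p])
    have hq : Real.exp (-q ^ 2) ≤ 1 := Real.exp_le_one_iff.2 (by nlinarith [sq_nonneg q])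
    have hp' := Real.exp_pos (-p ^ 2)
    have hq' := Real.exp_pos (-q ^ 2)
    rw [abs_le]
    constructor <;> linarith
  refine Real.le_sqrt_of_sq_le ?_
  nlinarith [abs_nonneg (Real.exp (-p ^ 2) - Real.exp (-q ^ 2))]

lemma inv_sqrt_four_pi_mul_le {r : ℝ} (hr : 0 < r) :
    (Real.sqrt (4 * Real.pi * r))⁻¹ ≤ r ^ (-(1 / 2) : ℝ) := by
  rw [Real.rpow_neg hr.le, ← Real.sqrt_eq_rpow]
  have hs : 0 < Real.sqrt r := Real.sqrt_pos.2 hr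
  gcongr
  nlinarith [Real.pi_gt_three]

lemma heatKernel_nonneg (x t ξ τ : ℝ) : 0 ≤ heatKernel x t ξ τ := by
  unfold heatKernel
  positivity

lemma heatKernel_le {x t ξ τ : ℝ} (a : ℝ) (h : τ < t) :
    heatKernel x t ξ τ ≤
      (t - τ) ^ (-(1 / 2) : ℝ) * Real.exp (a ^ 2 * (t - τ) - a * |x - ξ|) := by
  have hr : 0 < t - τ := sub_pos.2 h
  rw [heatKernel, div_eq_inv_mul]
  gcongr
  · exact inv_sqrt_four_pi_mul_le hr
  · rw [div_le_iff₀ (by linarith), ← sq_abs (x - ξ)]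
    -- Completing the square; `a` is free and later becomes the decay rate.
    nlinarith [sq_nonneg (|x - ξ| - 2 * a * (t - τ))]

/-- Rescaling space by `2√(t - τ)` adds a factor `(t - τ)^(-1/4)` to the prefactor `(t - τ)^(-1/2)`.
-/
lemma abs_heatKernel_sub_le {x y t ξ τ : ℝ} (h : τ < t) :
    |heatKernel x t ξ τ - heatKernel y t ξ τ| ≤
      (t - τ) ^ (-(3 / 4) : ℝ) * Real.sqrt |x - y| := by
  have hr : 0 < t - τ := sub_pos.2 h
  have hs : 0 < Real.sqrt (t - τ) := Real.sqrt_pos.2 hr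
  have hexp : ∀ z : ℝ, Real.exp (-(z - ξ) ^ 2 / (4 * (t - τ))) =
      Real.exp (-((z - ξ) / (2 * Real.sqrt (t - τ))) ^ 2) := by
    intro z
    rw [div_pow, mul_pow, Real.sq_sqrt hr.le]
    norm_num [neg_div]
  have hdiff : |(x - ξ) / (2 * Real.sqrt (t - τ)) - (y - ξ) / (2 * Real.sqrt (t - τ))| ≤
      |x - y| / Real.sqrt (t - τ) := by
    rw [← sub_div, abs_div, abs_of_pos (by positivity : 0 < 2 * Real.sqrt (t - τ))]
    have : x - ξ - (y - ξ) = x - y := by ring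
    rw [this]
    gcongr
    linarith
  have hpow : (t - τ) ^ (-(3 / 4) : ℝ) =
      (t - τ) ^ (-(1 / 2) : ℝ) * (Real.sqrt (Real.sqrt (t - τ)))⁻¹ := by
    rw [Real.sqrt_eq_rpow, Real.sqrt_eq_rpow, ← Real.rpow_mul hr.le, ← Real.rpow_neg hr.le,
      ← Real.rpow_add hr]
    norm_num
  rw [heatKernel, heatKernel, ← sub_div, abs_div, abs_of_nonneg (Real.sqrt_nonneg _), hexp, hexp,
    div_eq_inv_mul, hpow, mul_assoc ((t - τ) ^ (-(1 / 2) : ℝ))]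
  gcongr
  · exact inv_sqrt_four_pi_mul_le hr
  · refine (abs_exp_neg_sq_sub_le _ _).trans ((Real.sqrt_le_sqrt hdiff).trans_eq ?_)
    rw [Real.sqrt_div (abs_nonneg _), div_eq_inv_mul]

/-- The integral `∫₀^∞ σ^p e^{-cσ} dσ`. -/
def expMoment (p c : ℝ) : ℝ := ∫ σ in Ioi (0 : ℝ), σ ^ p * Real.exp (-c * σ)

lemma integrableOn_rpow_mul_exp {p c : ℝ} (hp : -1 < p) (hc : 0 < c) :
    IntegrableOn (fun σ : ℝ => σ ^ p * Real.exp (-c * σ)) (Ioi 0) := by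
  simpa using integrableOn_rpow_mul_exp_neg_mul_rpow (p := 1) hp one_pos hc

lemma intervalIntegrable_rpow_mul_exp_sub {p c t : ℝ} (hp : -1 < p) (hc : 0 < c) (ht : 0 ≤ t) :
    IntervalIntegrable (fun τ : ℝ => (t - τ) ^ p * Real.exp (-c * (t - τ))) volume 0 t := by
  have h : IntervalIntegrable (fun σ : ℝ => σ ^ p * Real.exp (-c * σ)) volume 0 t :=
    (intervalIntegrable_iff_integrableOn_Ioc_of_le ht).2
      ((integrableOn_rpow_mul_exp hp hc).mono_set Ioc_subset_Ioi_self)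
  simpa using (h.comp_sub_left t).symm

lemma abs_intervalIntegral_le_expMoment {p c A t : ℝ} (hp : -1 < p) (hc : 0 < c) (hA : 0 ≤ A)
    (ht : 0 ≤ t) {F : ℝ → ℝ}
    (hF : ∀ τ ∈ Ioo 0 t, |F τ| ≤ A * ((t - τ) ^ p * Real.exp (-c * (t - τ)))) :
    |∫ τ in (0 : ℝ)..t, F τ| ≤ A * expMoment p c := by
  have h1 : ∀ᵐ τ ∂volume, τ ∈ Ioc 0 t →
      ‖F τ‖ ≤ A * ((t - τ) ^ p * Real.exp (-c * (t - τ))) := by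
    -- The singular endpoint `τ = t` is discarded as a null set.
    filter_upwards [Measure.ae_ne volume t] with τ hτ hτ'
    exact hF τ ⟨hτ'.1, lt_of_le_of_ne hτ'.2 hτ⟩
  have h2 := intervalIntegral.norm_integral_le_of_norm_le ht h1
    ((intervalIntegrable_rpow_mul_exp_sub hp hc ht).const_mul A)
  refine h2.trans ?_
  rw [intervalIntegral.integral_const_mul,
    intervalIntegral.integral_comp_sub_left (fun σ => σ ^ p * Real.exp (-c * σ)) t, sub_self,
    sub_zero, intervalIntegral.integral_of_le ht]
  gcongr
  refine setIntegral_mono_set (integrableOn_rpow_mul_exp hp hc) ?_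
    Ioc_subset_Ioi_self.eventuallyLE
  refine (ae_restrict_mem measurableSet_Ioi).mono fun σ hσ => ?_
  have : (0 : ℝ) < σ := hσ
  simp only [Pi.zero_apply]
  positivity

variable {v : ℝ → ℝ} {V : ℝ}

lemma integrableOn_velocity (hv : ContinuousOn v (Ici 0)) {a b : ℝ} (ha : 0 ≤ a) :
    IntegrableOn v (Icc a b) :=
  (hv.mono fun _ hx => ha.trans hx.1).integrableOn_Icc

lemma abs_position_sub_le (hv : ContinuousOn v (Ici 0)) (hV : ∀ t, 0 < t → |v t| ≤ V) {τ t : ℝ}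
    (hτ : 0 ≤ τ) (h : τ ≤ t) : |position v t - position v τ| ≤ V * (t - τ) := by
  have hint : ∀ s, 0 ≤ s → IntervalIntegrable v volume 0 s := fun s hs =>
    (intervalIntegrable_iff_integrableOn_Icc_of_le hs).2 (integrableOn_velocity hv le_rfl)
  rw [position, position, intervalIntegral.integral_interval_sub_left (hint t (hτ.trans h))
    (hint τ hτ)]
  have := intervalIntegral.norm_integral_le_of_norm_le_const (a := τ) (b := t) (f := v) (C := V)
    fun x hx => by
      rw [uIoc_of_le h] at hx
      exact hV x (hτ.trans_lt hx.1)
  rwa [abs_of_nonneg (sub_nonneg.2 h)] at this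

lemma continuousOn_position (hv : ContinuousOn v (Ici 0)) {t : ℝ} (ht : 0 ≤ t) :
    ContinuousOn (position v) (Icc 0 t) := by
  have := intervalIntegral.continuousOn_primitive_interval (a := 0) (b := t) (f := v)
    (μ := volume) (by rw [uIcc_of_le ht]; exact integrableOn_velocity hv le_rfl)
  rwa [uIcc_of_le ht] at this

/-- The density of the single-layer potential `T1` in time. -/
def layerDensity (γ : ℝ) (v : ℝ → ℝ) (t x τ : ℝ) : ℝ :=
  Real.exp (-γ * (t - τ)) * heatKernel (x + position v t) t (position v τ) τ * v τ

lemma T1_eq (γ : ℝ) (v : ℝ → ℝ) (t x : ℝ) :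
    T1 γ v t x = -∫ τ in (0 : ℝ)..t, layerDensity γ v t x τ := rfl

lemma abs_layerDensity_le (hv : ContinuousOn v (Ici 0)) (hV : ∀ t, 0 < t → |v t| ≤ V)
    (γ : ℝ) {α : ℝ} (hα : 0 ≤ α) {t τ : ℝ} (hτ : τ ∈ Ioo 0 t) (x : ℝ) :
    |layerDensity γ v t x τ| ≤ V * Real.exp (-α * |x|) *
      ((t - τ) ^ (-(1 / 2) : ℝ) * Real.exp (-kappa γ V α * (t - τ))) := by
  have hr : 0 < t - τ := sub_pos.2 hτ.2
  have hvτ := hV τ hτ.1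
  have hV0 : 0 ≤ V := (abs_nonneg _).trans hvτ
  have hs := abs_position_sub_le hv hV hτ.1.le hτ.2.le
  -- The interface has moved by at most `V (t - τ)` since time `τ`.
  have hx : |x| - V * (t - τ) ≤ |x + position v t - position v τ| := by
    have h1 := abs_sub_abs_le_abs_sub x (-(position v t - position v τ))
    rw [abs_neg, sub_neg_eq_add, ← add_sub_assoc] at h1
    linarith
  rw [layerDensity, abs_mul, abs_mul, Real.abs_exp, abs_of_nonneg (heatKernel_nonneg _ _ _ _)]
  calc
    _ ≤ Real.exp (-γ * (t - τ)) * ((t - τ) ^ (-(1 / 2) : ℝ) * Real.exp (α ^ 2 * (t - τ) -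
          α * |x + position v t - position v τ|)) * V := by
        gcongr
        exact heatKernel_le α hτ.2
    _ ≤ Real.exp (-γ * (t - τ)) * ((t - τ) ^ (-(1 / 2) : ℝ) * Real.exp (α ^ 2 * (t - τ) -
          α * (|x| - V * (t - τ)))) * V := by
        gcongr
    _ = _ := by
        have : Real.exp (-α * |x|) * Real.exp (-kappa γ V α * (t - τ)) =
            Real.exp (-γ * (t - τ)) * Real.exp (α ^ 2 * (t - τ) - α * (|x| - V * (t - τ))) := by
          rw [← Real.exp_add, ← Real.exp_add, kappa]
          congr 1
          ring
        linear_combination (-V * (t - τ) ^ (-(1 / 2) : ℝ)) * this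

lemma abs_layerDensity_sub_le (hV : ∀ t, 0 < t → |v t| ≤ V) (γ : ℝ) {t τ : ℝ}
    (hτ : τ ∈ Ioo 0 t) (x y : ℝ) :
    |layerDensity γ v t x τ - layerDensity γ v t y τ| ≤ V * Real.sqrt |x - y| *
      ((t - τ) ^ (-(3 / 4) : ℝ) * Real.exp (-γ * (t - τ))) := by
  have hr : 0 < t - τ := sub_pos.2 hτ.2
  have h := abs_heatKernel_sub_le (x := x + position v t) (y := y + position v t)
    (ξ := position v τ) hτ.2
  rw [add_sub_add_right_eq_sub] at h
  rw [layerDensity, layerDensity, ← sub_mul, ← mul_sub, abs_mul, abs_mul, Real.abs_exp]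
  calc
    _ ≤ Real.exp (-γ * (t - τ)) * ((t - τ) ^ (-(3 / 4) : ℝ) * Real.sqrt |x - y|) * V := by
        gcongr
        exact hV τ hτ.1
    _ = _ := by ring

lemma continuousOn_layerDensity (hv : ContinuousOn v (Ici 0)) (γ : ℝ) {t : ℝ} (ht : 0 ≤ t)
    (x : ℝ) : ContinuousOn (layerDensity γ v t x) (Ioo 0 t) := by
  have h1 : ContinuousOn (position v) (Ioo 0 t) := (continuousOn_position hv ht).mono
    Ioo_subset_Icc_self
  have h2 : ContinuousOn v (Ioo 0 t) := hv.mono fun τ hτ => hτ.1.le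
  unfold layerDensity heatKernel
  refine ContinuousOn.mul (ContinuousOn.mul (by fun_prop) (ContinuousOn.div ?_ (by fun_prop) ?_)) h2
  · refine (ContinuousOn.div (by fun_prop) (by fun_prop) fun τ hτ => ?_).rexp
    exact (mul_pos four_pos (sub_pos.2 hτ.2)).ne'
  · intro τ hτ
    have := sub_pos.2 hτ.2
    positivity

lemma intervalIntegrable_layerDensity (hv : ContinuousOn v (Ici 0))
    (hV : ∀ t, 0 < t → |v t| ≤ V) {γ : ℝ} (hγ : 0 < γ) {t : ℝ} (ht : 0 ≤ t) (x : ℝ) :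
    IntervalIntegrable (layerDensity γ v t x) volume 0 t := by
  have hb := (intervalIntegrable_rpow_mul_exp_sub (p := -(1 / 2)) (c := γ) (by norm_num) hγ
    ht).const_mul V
  rw [intervalIntegrable_iff_integrableOn_Ioo_of_le ht] at hb ⊢
  refine Integrable.mono' hb
    ((continuousOn_layerDensity hv γ ht x).aestronglyMeasurable measurableSet_Ioo) ?_
  refine (ae_restrict_mem measurableSet_Ioo).mono fun τ hτ => ?_
  -- Decay rate `0`: the weight becomes `1` and `kappa` becomes `γ`.
  simpa [kappa] using abs_layerDensity_le hv hV γ le_rfl hτ x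

/-- The single-layer potentials belong to one class of functions with uniform exponential decay
and a uniform Hölder constant. -/
lemma T1_mem_decayingHolder (hv : ContinuousOn v (Ici 0)) (hV : ∀ t, 0 < t → |v t| ≤ V)
    {γ α : ℝ} (hγ : 0 < γ) (hα : 0 ≤ α) (hκ : 0 < kappa γ V α) {t : ℝ} (ht : 0 ≤ t) :
    T1 γ v t ∈ decayingHolder α (V * expMoment (-(1 / 2)) (kappa γ V α))
      (V * expMoment (-(3 / 4)) γ) := by
  have hV0 : 0 ≤ V := (abs_nonneg _).trans (hV 1 one_pos)
  constructor
  · intro x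
    rw [T1_eq, abs_neg]
    refine (abs_intervalIntegral_le_expMoment (by norm_num) hκ (by positivity) ht fun τ hτ =>
      abs_layerDensity_le hv hV γ hα hτ x).trans_eq ?_
    ring
  · intro x y
    rw [T1_eq, T1_eq, neg_sub_neg, abs_sub_comm, ← intervalIntegral.integral_sub
      (intervalIntegrable_layerDensity hv hV hγ ht x)
      (intervalIntegrable_layerDensity hv hV hγ ht y)]
    refine (abs_intervalIntegral_le_expMoment (by norm_num) hγ (by positivity) ht fun τ hτ =>
      abs_layerDensity_sub_le hV γ hτ x y).trans_eq ?_
    ring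

/-! ### Estimates of the contribution of the initial data -/

lemma abs_le_of_mem_initialBall {I : Set ℝ} {α N : ℝ} (hN : 0 ≤ N) {u : ℝ → ℝ}
    (hu : u ∈ initialBall I α N) (x : ℝ) : |u x| ≤ N * Real.exp (-α * |x|) := by
  have h : ENNReal.ofReal (Real.exp (α * |x|) * |u x|) ≤ ENNReal.ofReal N :=
    (le_iSup (fun x : ℝ => ENNReal.ofReal (Real.exp (α * |x|) * |u x|)) x).trans hu.2.2
  rw [ENNReal.ofReal_le_ofReal_iff hN] at h
  rw [neg_mul, Real.exp_neg, ← div_eq_mul_inv, le_div_iff₀ (Real.exp_pos _), mul_comm]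
  exact h

lemma heatKernel_eq_gaussianPDFReal {t : ℝ} (ht : 0 < t) (y z : ℝ) :
    heatKernel y t (z + y) 0 = ProbabilityTheory.gaussianPDFReal 0 (2 * t).toNNReal z := by
  rw [heatKernel, ProbabilityTheory.gaussianPDFReal, Real.coe_toNNReal _ (by positivity),
    div_eq_inv_mul, sub_zero, sub_zero]
  have h1 : (y - (z + y)) ^ 2 = z ^ 2 := by ring
  have h2 : 4 * Real.pi * t = 2 * Real.pi * (2 * t) := by ring
  have h3 : 4 * t = 2 * (2 * t) := by ring
  rw [h1, h2, h3]

/-- Substituting `ξ = x + s(t) + z` turns the heat convolution into a mean over a probability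
measure, so the contraction estimates become instances of Jensen's inequality. -/
lemma T2_eq (γ : ℝ) (v u : ℝ → ℝ) {t : ℝ} (ht : 0 < t) (x : ℝ) :
    T2 γ v u t x = Real.exp (-γ * t) *
      ∫ z, u (x + (position v t + z))
        ∂(ProbabilityTheory.gaussianReal 0 (2 * t).toNNReal) := by
  have hne : (2 * t).toNNReal ≠ 0 := by simpa using ht
  rw [T2, if_neg ht.ne', ProbabilityTheory.integral_gaussianReal_eq_integral_smul hne,
    ← integral_add_right_eq_self _ (x + position v t)]
  congr 2
  ext z
  rw [heatKernel_eq_gaussianPDFReal ht, smul_eq_mul]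
  congr 2
  ring

lemma abs_T2_le {γ : ℝ} (v : ℝ → ℝ) {u : ℝ → ℝ} {N t : ℝ} (hu : ∀ x, |u x| ≤ N) (ht : 0 ≤ t)
    (x : ℝ) : |T2 γ v u t x| ≤ Real.exp (-γ * t) * N := by
  rcases ht.eq_or_lt with rfl | ht
  · simpa [T2] using hu x
  · rw [T2_eq γ v u ht, abs_mul, Real.abs_exp]
    gcongr
    simpa using norm_integral_le_of_norm_le_const
      (μ := ProbabilityTheory.gaussianReal 0 (2 * t).toNNReal)
      (f := fun z => u (x + (position v t + z))) (C := N) (Eventually.of_forall fun z => hu _)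

/-- Averaging translates over a probability measure is a contraction of `L²`. -/
lemma eLpNorm_integral_translate_le {μ : Measure ℝ} [IsProbabilityMeasure μ] {u : ℝ → ℝ}
    (hu : Measurable u) (s : ℝ) :
    eLpNorm (fun x => ∫ z, u (x + (s + z)) ∂μ) 2 volume ≤ eLpNorm u 2 volume := by
  refine (ENNReal.pow_le_pow_left_iff two_ne_zero).1 ?_
  rw [eLpNorm_two_sq, eLpNorm_two_sq]
  calc
    _ ≤ ∫⁻ x, ∫⁻ z, ‖u (x + (s + z))‖ₑ ^ 2 ∂μ := by
        refine lintegral_mono fun x => ?_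
        have hm : Measurable fun z => u (x + (s + z)) := by fun_prop
        -- Jensen's inequality, in the form `L¹ ≤ L²` on a probability space; Tonelli and
        -- translation invariance then conclude.
        have h := eLpNorm_le_eLpNorm_of_exponent_le (μ := μ) one_le_two hm.aestronglyMeasurable
        rw [eLpNorm_one_eq_lintegral_enorm] at h
        rw [← eLpNorm_two_sq (fun z => u (x + (s + z))) μ]
        gcongr
        exact (enorm_integral_le_lintegral_enorm _).trans h
    _ = ∫⁻ z, (∫⁻ x, ‖u (x + (s + z))‖ₑ ^ 2) ∂μ := by
        have hm : Measurable (Function.uncurry fun x z => ‖u (x + (s + z))‖ₑ ^ 2) := by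
          unfold Function.uncurry
          fun_prop
        exact lintegral_lintegral_swap hm.aemeasurable
    _ = ∫⁻ x, ‖u x‖ₑ ^ 2 := by
        have ht : ∀ z, ∫⁻ x, ‖u (x + (s + z))‖ₑ ^ 2 = ∫⁻ x, ‖u x‖ₑ ^ 2 := fun z =>
          lintegral_add_right_eq_self (fun x => ‖u x‖ₑ ^ 2) (s + z)
        simp [ht]

lemma aestronglyMeasurable_T2 (γ : ℝ) (v : ℝ → ℝ) {u : ℝ → ℝ} (hu : Continuous u) {t : ℝ}
    (ht : 0 ≤ t) : AEStronglyMeasurable (T2 γ v u t) volume := by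
  rcases ht.eq_or_lt with rfl | ht
  · rw [show T2 γ v u 0 = u from funext fun x => if_pos rfl]
    exact hu.aestronglyMeasurable
  · have h : StronglyMeasurable fun x => ∫ z, u (x + (position v t + z))
        ∂(ProbabilityTheory.gaussianReal 0 (2 * t).toNNReal) := by
      refine StronglyMeasurable.integral_prod_right'
        (f := fun p : ℝ × ℝ => u (p.1 + (position v t + p.2))) ?_
      exact Continuous.stronglyMeasurable (by fun_prop)
    rw [show T2 γ v u t = _ from funext (T2_eq γ v u ht)]
    exact (h.const_mul _).aestronglyMeasurable

lemma eLpNorm_T2_le (γ : ℝ) (v : ℝ → ℝ) {u : ℝ → ℝ} (hu : Measurable u) {t : ℝ} (ht : 0 ≤ t) :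
    eLpNorm (T2 γ v u t) 2 volume ≤
      ENNReal.ofReal (Real.exp (-γ * t)) * eLpNorm u 2 volume := by
  rcases ht.eq_or_lt with rfl | ht
  · simp [show T2 γ v u 0 = u from funext fun x => if_pos rfl]
  · rw [show T2 γ v u t = Real.exp (-γ * t) • _ from funext (T2_eq γ v u ht), eLpNorm_const_smul,
      ← ofReal_norm, Real.norm_eq_abs, Real.abs_exp]
    gcongr
    exact eLpNorm_integral_translate_le hu _

/-! ### The constants and the kinetics -/

/-- `alphaTime` is the positive root of `α² + α V₀ - γ`. -/
lemma kappa_pos_of_lt_alphaTime {γ V₀ α : ℝ} (hγ : 0 < γ) (hV : 0 < V₀) (hα : 0 < α)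
    (h : α < alphaTime γ V₀) : 0 < kappa γ V₀ α := by
  have h1 : 2 * α / V₀ + 1 < Real.sqrt (1 + 4 * γ / V₀ ^ 2) := by
    rw [alphaTime, div_mul_eq_mul_div, lt_div_iff₀ two_pos] at h
    rw [← lt_sub_iff_add_lt, div_lt_iff₀ hV]
    linarith
  rw [Real.lt_sqrt (by positivity)] at h1
  have h2 : V₀ ^ 2 * (2 * α / V₀ + 1) ^ 2 < V₀ ^ 2 * (1 + 4 * γ / V₀ ^ 2) := by gcongr
  have h3 : V₀ ^ 2 * (2 * α / V₀ + 1) ^ 2 = (2 * α + V₀) ^ 2 := by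
    field_simp
  have h4 : V₀ ^ 2 * (1 + 4 * γ / V₀ ^ 2) = V₀ ^ 2 + 4 * γ := by
    field_simp
  rw [kappa]
  nlinarith

lemma IsVelocity.abs_le {γ : ℝ} {I : Set ℝ} {g u₀ v : ℝ → ℝ} {V₀ v₀ : ℝ}
    (hg : IsKinetics I g V₀ v₀) (hv : IsVelocity γ I g u₀ v) {t : ℝ} (ht : 0 < t) :
    |v t| ≤ V₀ := by
  obtain ⟨hI, hvt⟩ := hv.2 t ht
  rw [hvt, _root_.abs_le]
  exact ⟨hg.lower _ hI, by linarith [hg.upper _ hI, hg.v_pos, hg.V_pos]⟩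

lemma orbitT1_subset_decayingHolder {γ V₀ v₀ α : ℝ} {I : Set ℝ} {g : ℝ → ℝ} (hγ : 0 < γ)
    (hg : IsKinetics I g V₀ v₀) (hα : 0 < α) (hκ : 0 < kappa γ V₀ α) (X : Set (ℝ → ℝ)) {t₀ : ℝ}
    (ht₀ : 0 ≤ t₀) :
    orbitT1 γ I g X t₀ ⊆ decayingHolder α (V₀ * expMoment (-(1 / 2)) (kappa γ V₀ α))
      (V₀ * expMoment (-(3 / 4)) γ) := by
  rintro f ⟨u₀, -, v, hv, t, ht, rfl⟩
  exact T1_mem_decayingHolder hv.1 (fun t ht => hv.abs_le hg ht) hγ hα.le hκ (ht₀.trans ht)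

lemma abs_lt_of_weightedSupNorm_lt {α δ : ℝ} (hα : 0 ≤ α) {f : ℝ → ℝ}
    (h : weightedSupNorm α f < ENNReal.ofReal δ) (x : ℝ) : |f x| < δ := by
  have h1 := (le_iSup (fun x : ℝ => ENNReal.ofReal (Real.exp (α * |x|) * |f x|)) x).trans_lt h
  rw [ENNReal.ofReal_lt_ofReal_iff_of_nonneg (by positivity)] at h1
  refine lt_of_le_of_lt ?_ h1
  exact le_mul_of_one_le_left (abs_nonneg _) (Real.one_le_exp (by positivity))

/-- Since the contribution of the initial data dies out, every element of the `ω`-limit set is a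
pointwise limit of single-layer potentials. -/
lemma omegaLimitSet_subset_closure_orbitT1 {γ α N : ℝ} {I : Set ℝ} {g : ℝ → ℝ} (hγ : 0 < γ)
    (hα : 0 ≤ α) (hN : 0 ≤ N) :
    omegaLimitSet γ I g α (initialBall I α N) ⊆ closure (orbitT1 γ I g (initialBall I α N) 0) := by
  intro f hf
  have hex : ∀ n : ℕ, ∃ h ∈ orbitT1 γ I g (initialBall I α N) 0, ∀ x,
      |h x - f x| ≤ 1 / ((n : ℝ) + 1) + Real.exp (-γ * n) * N := by
    intro n
    -- Taking `t₀ = n` makes the damping of the initial data at least `exp (-γ n)` strong.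
    have hfn : f ∈ closureCAlpha α (orbitT γ I g (initialBall I α N) n) :=
      mem_iInter₂.1 hf n (mem_Ici.2 n.cast_nonneg)
    obtain ⟨_, ⟨u, hu, v, hv, t, ht, rfl⟩, hlt⟩ := hfn.2 (ENNReal.ofReal (1 / ((n : ℝ) + 1)))
      (ENNReal.ofReal_pos.2 (by positivity))
    have ht0 : 0 ≤ t := n.cast_nonneg.trans ht
    refine ⟨T1 γ v t, ⟨u, hu, v, hv, t, ht0, rfl⟩, fun x => ?_⟩
    have h1 := abs_lt_of_weightedSupNorm_lt hα hlt x
    have hub : ∀ x, |u x| ≤ N := fun x => (abs_le_of_mem_initialBall hN hu x).trans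
      (mul_le_of_le_one_right hN (Real.exp_le_one_iff.2 (by nlinarith [abs_nonneg x])))
    have h2 : |T2 γ v u t x| ≤ Real.exp (-γ * n) * N := by
      refine (abs_T2_le v hub ht0 x).trans ?_
      gcongr ?_ * _
      exact Real.exp_le_exp.2 (by nlinarith)
    have h3 : T1 γ v t x - f x = -((f - T γ v u t) x) - T2 γ v u t x := by
      simp only [Pi.sub_apply, T]
      ring
    rw [h3]
    refine (abs_sub _ _).trans ?_
    rw [abs_neg]
    exact add_le_add h1.le h2
  choose h hmem hle using hex
  refine mem_closure_of_tendsto (f := h) (b := atTop) (tendsto_pi_nhds.2 fun x => ?_)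
    (Eventually.of_forall hmem)
  rw [tendsto_iff_norm_sub_tendsto_zero]
  refine squeeze_zero (fun n => norm_nonneg _) (fun n => hle n x) ?_
  have he : Tendsto (fun n : ℕ => Real.exp (-γ * n)) atTop (𝓝 0) :=
    Real.tendsto_exp_atBot.comp
      (tendsto_natCast_atTop_atTop.const_mul_atTop_of_neg (neg_lt_zero.2 hγ))
  simpa using tendsto_one_div_add_atTop_nhds_zero_nat.add (he.mul_const N)

end Stefan

end

theorem mainTheorem7 :
    ∃ C : ℝ, 0 < C ∧
      ∀ (γ V₀ v₀ : ℝ) (I : Set ℝ) (g : ℝ → ℝ), 0 < γ → Stefan.IsKinetics I g V₀ v₀ →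
      ∀ α : ℝ, 0 < α → α < Stefan.alphaMin γ V₀ v₀ →
        (0 < Stefan.kappa γ V₀ α ∧
          ∀ N : ℝ, 0 ≤ N → ∀ u₀ ∈ Stefan.initialBall I α N,
          ∀ v : ℝ → ℝ, Stefan.IsVelocity γ I g u₀ v → ∀ t : ℝ, 0 ≤ t →
            MeasureTheory.MemLp (Stefan.T2 γ v u₀ t) 2 MeasureTheory.volume ∧
            MeasureTheory.eLpNorm (Stefan.T2 γ v u₀ t) 2 MeasureTheory.volume ≤
              ENNReal.ofReal (C * Real.exp (-Stefan.kappa γ V₀ α * t) * N / Real.sqrt α)) ∧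
        (∀ N : ℝ, 0 ≤ N → ∀ t₀ : ℝ, 0 < t₀ →
          Stefan.RelativelyCompactInH0
            (Stefan.orbitT1 γ I g (Stefan.initialBall I α N) t₀)) ∧
        (∀ ε : ℝ, 0 < ε →
          Stefan.RelativelyCompactInH0 (Stefan.attractor γ I g V₀ α ε)) := by
  refine ⟨1, one_pos, fun γ V₀ v₀ I g hγ hg α hα hlt => ?_⟩
  have hκ : 0 < Stefan.kappa γ V₀ α :=
    Stefan.kappa_pos_of_lt_alphaTime hγ hg.V_pos hα (hlt.trans_le (min_le_left _ _))
  refine ⟨⟨hκ, fun N hN u hu v _ t ht => ?_⟩, fun N _ t₀ ht₀ => ?_, fun ε hε => ?_⟩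
  · have hbound : MeasureTheory.eLpNorm (Stefan.T2 γ v u t) 2 MeasureTheory.volume ≤
        ENNReal.ofReal (1 * Real.exp (-Stefan.kappa γ V₀ α * t) * N / Real.sqrt α) := by
      -- Here `κ ≤ γ`, so the true decay rate `γ` of the initial data is weakened to `κ`.
      have h1 : Real.exp (-γ * t) ≤ Real.exp (-Stefan.kappa γ V₀ α * t) := by
        refine Real.exp_le_exp.2 (mul_le_mul_of_nonneg_right ?_ ht)
        have := mul_pos hα hg.V_pos
        rw [Stefan.kappa]
        nlinarith
      rw [one_mul, mul_div_assoc, ENNReal.ofReal_mul (Real.exp_pos _).le]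
      refine (Stefan.eLpNorm_T2_le γ v hu.1.1.measurable ht).trans ?_
      gcongr
      exact Stefan.eLpNorm_le_of_abs_le_exp hα hN (Stefan.abs_le_of_mem_initialBall hN hu)
    exact ⟨⟨Stefan.aestronglyMeasurable_T2 γ v hu.1.1 ht,
      hbound.trans_lt ENNReal.ofReal_lt_top⟩, hbound⟩
  · exact Stefan.relativelyCompactInH0_of_subset_decayingHolder hα
      (Stefan.orbitT1_subset_decayingHolder hγ hg hα hκ _ ht₀.le)
  · have hN : 0 ≤ V₀ / Real.sqrt γ + ε := by
      have := hg.V_pos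
      positivity
    exact Stefan.relativelyCompactInH0_of_subset_decayingHolder hα
      ((Stefan.omegaLimitSet_subset_closure_orbitT1 hγ hα.le hN).trans
        (closure_minimal (Stefan.orbitT1_subset_decayingHolder hγ hg hα hκ _ le_rfl)
          (Stefan.isClosed_decayingHolder _ _ _)))
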